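/- Let $q$ be a prime power and $\ell\ge 2$ an integer, and put $N=\frac{q^\ell-1}{q-1}$ and $n=q^{\ell-1}(q^\ell-1)$. Let $t_1,t_2\ge 0$ be integers, and let $$M_1=\max\{t_1,N-2\},\quad M_2=\max\{t_2,q^{\ell-1}-2\},\quad m_1=\min\{t_1,N-2\},\quad m_2=\min\{t_2,q^{\ell-1}-2\}.$$ Suppose that $S=M_1q+M_2(q^\ell-1)\le n$. Then there is an $$[\,n,\ (m_1+1)(m_2+1),\ \ge n-S;\ N-1,\ q^{\ell-1}-1\,]$$ recoverable code over $\mathbb F_{q^\ell}$, that is, a linear code of length $n$, dimension $(m_1+1)(m_2+1)$ and minimum distance at least $n-S$ such that for each coordinate $i$ there are two disjoint sets $R_1,R_2$ of coordinates different from $i$, with $|R_1|=N-1$ and $|R_2|=q^{\ell-1}-1$, such that column $i$ of a generator matrix lies in the span of the columns indexed by $R_1$, and also in the span of the columns indexed by $R_2$. Explicitly, consider the Norm-Trace curve $y^{N}=\mathrm{Tr}(x):=x^{q^{\ell-1}}+\dots+x^q+x$ over $\mathbb F_{q^\ell}$ and the groups $$H_1=\{(x,y)\mapsto(x+a,y)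 : a\in\mathbb F_{q^\ell},\ \mathrm{Tr}(a)=0\},\qquad H_2=\{(x,y)\mapsto(x,\lambda y) : \lambda\in\mathbb F_{q^\ell},\ \lambda^{N}=1\}$$ of automorphisms of it. Let $\mathcal P$ be the set of the affine $\mathbb F_{q^\ell}$-rational points of the curve with trivial stabilizer in the group generated by $H_1$ and $H_2$, and let $V=V_1\cap V_2$, where, inside the ring of regular functions on the affine curve, $V_1$ is the $\mathbb F_{q^\ell}$-span of the functions $x^iy^j$ with $0\le i\le q^{\ell-1}-2$, $0\le j\le t_1$, and $V_2$ is the span of the functions $x^jy^i$ with $0\le i\le N-2$, $0\le j\le t_2$. Then the code $\{(f(P))_{P\in\mathcal P} : f\in V\}$ has all the properties above, and for the coordinate $P\in\mathcal P$ one may take $R_1$ to be the $H_2$-orbit of $P$ without $P$ and $R_2$ to be the $H_1$-orbit of $P$ without $P$. -/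

import Mathlib

open Polynomial

/-! ### Locally recoverable linear codes -/

/-- `G` is a generator matrix of the linear code `C`: its rows form a basis of `C`. -/
structure IsGeneratorMatrix {F ι : Type*} [Field F] {k : ℕ}
    (C : Submodule F (ι → F)) (G : Matrix (Fin k) ι F) : Prop where
  linearIndependent : LinearIndependent F (fun a : Fin k => G a)
  span_eq : Submodule.span F (Set.range fun a : Fin k => G a) = C

/-- `R 0, …, R (δ - 1)` are pairwise disjoint repair sets, of sizes `r 0, …, r (δ - 1)`, for the
coordinate `i` of the code with generator matrix `G`: none of them contains `i`, and the `i`-th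
column of `G` is a linear combination of the columns of `G` indexed by any one of them. -/
structure AreRepairSets {F ι : Type*} [Field F] {k δ : ℕ}
    (G : Matrix (Fin k) ι F) (i : ι) (r : Fin δ → ℕ) (R : Fin δ → Set ι) : Prop where
  notMem : ∀ j, i ∉ R j
  disjoint : Pairwise fun j j' => Disjoint (R j) (R j')
  card_eq : ∀ j, (R j).ncard = r j
  recovers : ∀ j, G.col i ∈ Submodule.span F (G.col '' R j)

/-- `C` is an `[n, k, ≥ d; r 0, …, r (δ - 1)]` recoverable code: a linear code of length `n`,
dimension `k` and minimum distance at least `d`, each of whose coordinates has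
`(r 0, …, r (δ - 1))`-locality. -/
structure IsRecoverableCode {F ι : Type*} [Field F] [DecidableEq F] [Fintype ι] {δ : ℕ}
    (C : Submodule F (ι → F)) (n k d : ℕ) (r : Fin δ → ℕ) : Prop where
  length_eq : Fintype.card ι = n
  finrank_eq : Module.finrank F C = k
  le_dist : ∀ c ∈ C, ∀ c' ∈ C, c ≠ c' → d ≤ hammingDist c c'
  locality : ∀ G : Matrix (Fin k) ι F, IsGeneratorMatrix C G →
    ∀ i : ι, ∃ R : Fin δ → Set ι, AreRepairSets G i r R

/-! ### The Norm-Trace curve -/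

namespace NormTrace

/-- The exponent `(q ^ ℓ - 1) / (q - 1)` of the norm map from `𝔽_{q^ℓ}` to `𝔽_q`. -/
def normExp (q ℓ : ℕ) : ℕ := (q ^ ℓ - 1) / (q - 1)

/-- The trace polynomial `u ^ (q ^ (ℓ - 1)) + ⋯ + u ^ q + u`. -/
def tr {R : Type*} [CommRing R] (q ℓ : ℕ) (u : R) : R := ∑ i ∈ Finset.range ℓ, u ^ q ^ i

variable (F : Type*) [Field F] (q ℓ : ℕ)

/-- The polynomial `Tr(x) - y ^ ((q ^ ℓ - 1) / (q - 1))` in `F[y][x]`: the outer variable is `x`,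
the inner variable is `y`. -/
noncomputable def curvePoly : F[X][X] := tr q ℓ X - C (X ^ normExp q ℓ)

/-- The affine coordinate ring `F[x, y] / (y ^ ((q ^ ℓ - 1) / (q - 1)) - Tr(x))`. -/
abbrev CoordRing : Type _ := AdjoinRoot (curvePoly F q ℓ)

/-- The coordinate function `x`. -/
noncomputable def x : CoordRing F q ℓ := AdjoinRoot.root (curvePoly F q ℓ)

/-- The coordinate function `y`. -/
noncomputable def y : CoordRing F q ℓ := AdjoinRoot.of (curvePoly F q ℓ) X

/-- The `F`-rational points of the affine curve; the value of the function `f` at `P` is `P f`. -/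
abbrev Point : Type _ := CoordRing F q ℓ →ₐ[F] F

/-- The group of the automorphisms `(x, y) ↦ (x + a, y)` with `Tr(a) = 0` (when `F` has `q ^ ℓ`
elements, these automorphisms already form a group). -/
noncomputable def translationGroup : Subgroup (CoordRing F q ℓ ≃ₐ[F] CoordRing F q ℓ) :=
  Subgroup.closure {σ | ∃ a : F, tr q ℓ a = 0 ∧
    σ (x F q ℓ) = x F q ℓ + algebraMap F _ a ∧ σ (y F q ℓ) = y F q ℓ}

/-- The group of the automorphisms `(x, y) ↦ (x, b y)` with `b ^ ((q ^ ℓ - 1) / (q - 1)) = 1`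
(these automorphisms already form a group). -/
noncomputable def scalingGroup : Subgroup (CoordRing F q ℓ ≃ₐ[F] CoordRing F q ℓ) :=
  Subgroup.closure {σ | ∃ b : F, b ^ normExp q ℓ = 1 ∧
    σ (x F q ℓ) = x F q ℓ ∧ σ (y F q ℓ) = b • y F q ℓ}

variable {F q ℓ}

/-- The image `σ(P)` of a rational point: `f(σ(P)) = (σ⁻¹ f)(P)`. -/
noncomputable def move (σ : CoordRing F q ℓ ≃ₐ[F] CoordRing F q ℓ) (P : Point F q ℓ) : Point F q ℓ :=
  P.comp σ.symm.toAlgHom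

variable (F q ℓ)

/-- The evaluation points: the affine rational points whose orbit under the group generated by
the translations and the scalings is long, that is, whose stabilizer is trivial (these are the
rational points lying over completely split places of the fixed field). -/
def evalPoints : Set (Point F q ℓ) :=
  {P | ∀ σ ∈ translationGroup F q ℓ ⊔ scalingGroup F q ℓ, move σ P = P → σ = 1}

variable {F q ℓ}

/-- The orbit of the evaluation point `P` under the group `H`, with `P` itself removed. -/
def puncturedOrbit (H : Subgroup (CoordRing F q ℓ ≃ₐ[F] CoordRing F q ℓ))
    (P : evalPoints F q ℓ) : Set (evalPoints F q ℓ) :=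
  {Q | (∃ σ ∈ H, (Q : Point F q ℓ) = move σ P) ∧ Q ≠ P}

theorem point_ext {P Q : Point F q ℓ} (hx : P (x F q ℓ) = Q (x F q ℓ))
    (hy : P (y F q ℓ) = Q (y F q ℓ)) : P = Q := by
  have key : (P : CoordRing F q ℓ →+* F) = Q := by
    refine AdjoinRoot.ringHom_ext (Polynomial.ringHom_ext (fun a => ?_) hy) hx
    have h : ((AdjoinRoot.of (curvePoly F q ℓ)) (C a)) = algebraMap F (CoordRing F q ℓ) a := rfl
    simp [h]
  refine AlgHom.ext fun f => ?_
  exact congrArg (fun φ : CoordRing F q ℓ →+* F => φ f) key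

instance [Finite F] : Finite (Point F q ℓ) :=
  Finite.of_injective (fun P : Point F q ℓ => (P (x F q ℓ), P (y F q ℓ))) fun _ _ h =>
    point_ext (congrArg Prod.fst h) (congrArg Prod.snd h)

noncomputable instance [Finite F] : Fintype (evalPoints F q ℓ) := Fintype.ofFinite _

variable (F q ℓ)

/-- The functions `∑_{i ≤ q^(ℓ-1) - 2} (∑_{j ≤ t₁} a_{ij} y ^ j) x ^ i`, `a_{ij} ∈ F`. -/
noncomputable def V₁ (t₁ : ℕ) : Submodule F (CoordRing F q ℓ) :=
  Submodule.span F {f | ∃ i j : ℕ, i ≤ q ^ (ℓ - 1) - 2 ∧ j ≤ t₁ ∧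
    f = y F q ℓ ^ j * x F q ℓ ^ i}

/-- The functions `∑_{i ≤ (q^ℓ-1)/(q-1) - 2} (∑_{j ≤ t₂} a_{ij} x ^ j) y ^ i`, `a_{ij} ∈ F`. -/
noncomputable def V₂ (t₂ : ℕ) : Submodule F (CoordRing F q ℓ) :=
  Submodule.span F {f | ∃ i j : ℕ, i ≤ normExp q ℓ - 2 ∧ j ≤ t₂ ∧
    f = x F q ℓ ^ j * y F q ℓ ^ i}

/-- Evaluation of functions at all the evaluation points. -/
noncomputable def ev : CoordRing F q ℓ →ₗ[F] (evalPoints F q ℓ → F) :=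
  LinearMap.pi fun P => (P : Point F q ℓ).toLinearMap

/-- The evaluation code of `V₁ ∩ V₂`. -/
noncomputable def code (t₁ t₂ : ℕ) : Submodule F (evalPoints F q ℓ → F) :=
  (V₁ F q ℓ t₁ ⊓ V₂ F q ℓ t₂).map (ev F q ℓ)

end NormTrace

/-! Write `N = normExp q ℓ` and `D = q ^ (ℓ - 1)`. A rational point has trivial stabilizer exactly
when `y ≠ 0` (`mem_evalPoints_iff`). The trace takes each value in 𝔽_q exactly `D` times and the
norm each nonzero one exactly `N` times, which gives the length and the orbit sizes. The `H₂`-orbit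
of a point is the set of evaluation points with the same `x`, its `H₁`-orbit the set with the same
`y`.

The monomials `y ^ j * x ^ i` with `i < D` are a basis of the coordinate ring. The bound `S ≤ n`
forces `t₂ < D`, so `V₁ ⊓ V₂` is spanned by those with `j ≤ m₁`, `i ≤ m₂`.

Locality: on an orbit such a function is a polynomial in one coordinate, of degree at most `N - 2`,
resp. `D - 2`, hence is interpolated from the rest of the orbit. Distance: instead of degrees of
divisors, a Schwartz-Zippel count (`le_card_filter_evalEval_ne_zero`) gives at least `(q ^ ℓ - D -
m₂) * (N - m₁)` nonzero values. This number is positive, so evaluation is injective and the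
dimension follows; it is at least `n - S` by `sub_le_mul_of_normExp`. -/

/-- Pigeonhole: at most `b` fibres of size at most `k` can exhaust `b * k` elements only if all are
full. It turns root bounds for the trace and norm polynomials into exact fibre sizes. -/
theorem Finset.card_fiber_eq_of_card_le {α β : Type*} [DecidableEq β] {s : Finset α}
    {t : Finset β} {f : α → β} {k b : ℕ} (hf : ∀ a ∈ s, f a ∈ t)
    (hk : ∀ c ∈ t, (s.filter fun a => f a = c).card ≤ k) (ht : t.card ≤ b)
    (hs : s.card = b * k) : ∀ c ∈ t, (s.filter fun a => f a = c).card = k := by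
  intro c hc
  refine le_antisymm (hk c hc) (not_lt.1 fun hlt => ?_)
  have h1 := Finset.card_eq_sum_card_fiberwise (f := f) (s := s) (t := t) hf
  have h2 := Finset.sum_lt_sum hk ⟨c, hc, hlt⟩
  rw [← h1, hs, Finset.sum_const, smul_eq_mul] at h2
  exact absurd (Nat.mul_le_mul_right k ht) (not_le.2 h2)

namespace NormTrace

/-! ### Arithmetic of the norm exponent and the trace polynomial -/

section Arithmetic

variable {q ℓ : ℕ}

theorem normExp_mul : normExp q ℓ * (q - 1) = q ^ ℓ - 1 :=
  Nat.div_mul_cancel (by simpa using Nat.sub_dvd_pow_sub_pow q 1 ℓ)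

theorem normExp_eq_sum (hq : 2 ≤ q) : normExp q ℓ = ∑ i ∈ Finset.range ℓ, q ^ i := by
  rw [normExp, Nat.geomSum_eq hq]

theorem succ_le_normExp (hq : 2 ≤ q) (hℓ : 2 ≤ ℓ) : q + 1 ≤ normExp q ℓ := by
  rw [normExp_eq_sum hq]
  obtain ⟨k, rfl⟩ := Nat.exists_eq_add_of_le hℓ
  rw [add_comm 2 k, Finset.sum_range_succ', Finset.sum_range_succ']
  simp

end Arithmetic

section Trace

variable {q ℓ : ℕ}

theorem tr_add {R : Type*} [CommRing R] {p k : ℕ} [Fact p.Prime] [CharP R p] (hq : q = p ^ k)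
    (u v : R) : tr q ℓ (u + v) = tr q ℓ u + tr q ℓ v := by
  simp only [tr, ← Finset.sum_add_distrib, hq, ← pow_mul, add_pow_char_pow]

theorem map_tr {R S : Type*} [CommRing R] [CommRing S] (φ : R →+* S) (u : R) :
    φ (tr q ℓ u) = tr q ℓ (φ u) := by
  simp [tr]

theorem tr_zero {R : Type*} [CommRing R] (hq : q ≠ 0) : tr q ℓ (0 : R) = 0 := by
  simp [tr, hq]

/-- Needed over `R = F`, to bound the fibres of the trace, and over `R = F[X]`, for the equation of
the curve. -/
theorem monic_tr_X_sub_C {R : Type*} [CommRing R] [Nontrivial R] (hq : 2 ≤ q) (hℓ : 1 ≤ ℓ) (c : R) :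
    (tr q ℓ (X : R[X]) - C c).Monic ∧ (tr q ℓ (X : R[X]) - C c).natDegree = q ^ (ℓ - 1) := by
  obtain ⟨k, rfl⟩ := Nat.exists_eq_add_of_le' hℓ
  have hlow : (∑ i ∈ Finset.range k, (X : R[X]) ^ q ^ i - C c).degree < (q ^ k : ℕ) := by
    refine lt_of_le_of_lt (degree_sub_le _ _) (max_lt ?_ ?_)
    · rw [degree_lt_iff_coeff_zero]
      intro m hm
      rw [finsetSum_coeff]
      refine Finset.sum_eq_zero fun i hi => ?_
      rw [coeff_X_pow, if_neg]
      have := Nat.pow_lt_pow_right hq (Finset.mem_range.1 hi)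
      omega
    · refine lt_of_le_of_lt degree_C_le ?_
      exact_mod_cast Nat.pow_pos (by omega)
  have heq : tr q (k + 1) (X : R[X]) - C c
      = X ^ q ^ k + (∑ i ∈ Finset.range k, (X : R[X]) ^ q ^ i - C c) := by
    rw [tr, Finset.sum_range_succ]
    ring
  rw [heq, Nat.add_sub_cancel]
  refine ⟨monic_X_pow_add hlow, natDegree_eq_of_degree_eq_some ?_⟩
  rw [degree_add_eq_left_of_degree_lt (by rwa [degree_X_pow]), degree_X_pow]

end Trace

/-! ### Fibres of trace and norm over the finite field -/

section FiniteField

variable {F : Type*} [Field F] {q ℓ : ℕ}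

theorem card_filter_pow_eq_le [DecidableEq F] {n : ℕ} (hn : n ≠ 0) (c : F) (s : Finset F) :
    (s.filter fun b => b ^ n = c).card ≤ n := by
  have hne : (X ^ n - C c : F[X]) ≠ 0 := X_pow_sub_C_ne_zero (Nat.pos_of_ne_zero hn) c
  refine (Finset.card_le_card (t := (X ^ n - C c : F[X]).roots.toFinset) fun b hb => ?_).trans
    ((Multiset.toFinset_card_le _).trans ((card_roots' _).trans natDegree_X_pow_sub_C.le))
  simp_all [sub_eq_zero]

theorem card_filter_tr_eq_le [Fintype F] [DecidableEq F] (hq : 2 ≤ q) (hℓ : 1 ≤ ℓ) (c : F) :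
    (Finset.univ.filter fun a : F => tr q ℓ a = c).card ≤ q ^ (ℓ - 1) := by
  obtain ⟨hm, hd⟩ := monic_tr_X_sub_C hq hℓ c
  refine (Finset.card_le_card (t := (tr q ℓ (X : F[X]) - C c).roots.toFinset) fun b hb => ?_).trans
    ((Multiset.toFinset_card_le _).trans ((card_roots' _).trans hd.le))
  have hev : (tr q ℓ (X : F[X])).eval b = tr q ℓ b := by
    simpa using map_tr (evalRingHom b) (X : F[X])
  simp_all [hm.ne_zero]

theorem exists_charP [Fintype F] (hq : IsPrimePow q) (hF : Fintype.card F = q ^ ℓ) :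
    ∃ p k : ℕ, p.Prime ∧ CharP F p ∧ q = p ^ k := by
  obtain ⟨p, k, hp, hk, rfl⟩ := hq
  refine ⟨p, k, hp.nat_prime, ?_, rfl⟩
  have : Fact p.Prime := ⟨hp.nat_prime⟩
  rw [← pow_mul] at hF
  exact charP_of_card_eq_prime_pow hF

theorem tr_pow [Fintype F] (hq : IsPrimePow q) (hF : Fintype.card F = q ^ ℓ)
    (a : F) : tr q ℓ a ^ q = tr q ℓ a := by
  obtain ⟨p, k, hp, hc, rfl⟩ := exists_charP hq hF
  have : Fact p.Prime := ⟨hp⟩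
  have h0 : (p ^ k) ^ 0 = 1 := pow_zero _
  rw [tr, sum_pow_char_pow]
  simp only [← pow_mul a, ← pow_succ]
  -- The sum over `i ≤ ℓ` is split off at its last and at its first term; these agree because `a ^
  -- (q ^ ℓ) = a`.
  have h := Finset.sum_range_succ' (fun i => a ^ (p ^ k) ^ i) ℓ
  rw [Finset.sum_range_succ, ← hF, FiniteField.pow_card, h0, pow_one] at h
  simpa using (add_right_cancel h).symm

theorem card_filter_pow_self_eq_le [Fintype F] [DecidableEq F] (hq : 2 ≤ q) :
    (Finset.univ.filter fun c : F => c ^ q = c).card ≤ q := by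
  have hne : (X ^ q - X : F[X]) ≠ 0 := FiniteField.X_pow_card_sub_X_ne_zero F (by omega)
  refine (Finset.card_le_card (t := (X ^ q - X : F[X]).roots.toFinset) fun b hb => ?_).trans
    ((Multiset.toFinset_card_le _).trans ((card_roots' _).trans
      (FiniteField.X_pow_card_sub_X_natDegree_eq F (by omega)).le))
  simp_all [sub_eq_zero]

/-- Pigeonhole: `q ^ ℓ` elements are sent to at most `q` fixed points of `c ↦ c ^ q`, with fibres of
size at most `q ^ (ℓ - 1)`. -/
theorem card_filter_tr_eq [Fintype F] [DecidableEq F] (hq : IsPrimePow q)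
    (hF : Fintype.card F = q ^ ℓ)
    (hℓ : 1 ≤ ℓ) {c : F} (hc : c ^ q = c) :
    (Finset.univ.filter fun a : F => tr q ℓ a = c).card = q ^ (ℓ - 1) := by
  refine Finset.card_fiber_eq_of_card_le (t := Finset.univ.filter fun c : F => c ^ q = c)
    (fun a _ => by simpa using tr_pow hq hF a)
    (fun c _ => card_filter_tr_eq_le hq.two_le hℓ c)
    (card_filter_pow_self_eq_le hq.two_le) ?_ c (by simpa using hc)
  rw [Finset.card_univ, hF, ← pow_succ', Nat.sub_add_cancel hℓ]

theorem norm_pow_self [Fintype F] (hq : IsPrimePow q) (hF : Fintype.card F = q ^ ℓ) (b : F) :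
    (b ^ normExp q ℓ) ^ q = b ^ normExp q ℓ := by
  have h2 := hq.two_le
  have hN := normExp_mul (q := q) (ℓ := ℓ)
  have hqN : normExp q ℓ * q = (q ^ ℓ - 1) + normExp q ℓ := by
    rw [← hN]
    obtain ⟨r, rfl⟩ := Nat.exists_eq_add_of_le' (by omega : 1 ≤ q)
    rw [Nat.add_sub_cancel]
    ring
  rw [← pow_mul, hqN, pow_add, ← hF]
  rcases eq_or_ne b 0 with rfl | hb
  · rcases Nat.eq_zero_or_pos (normExp q ℓ) with h0 | h0
    · rw [h0, zero_mul, ← hF] at hN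
      rw [← hN]
      simp
    · simp [h0.ne']
  · rw [FiniteField.pow_card_sub_one_eq_one b hb, one_mul]

/-- Pigeonhole again: the `(q - 1) * N` nonzero elements are sent to at most `q - 1` roots of unity,
with fibres of size at most `N`. -/
theorem card_filter_norm_eq [Fintype F] [DecidableEq F] (hq : IsPrimePow q)
    (hF : Fintype.card F = q ^ ℓ)
    (hℓ : 2 ≤ ℓ) {c : F} (hc : c ^ q = c) (hc0 : c ≠ 0) :
    (Finset.univ.filter fun b : F => b ^ normExp q ℓ = c).card = normExp q ℓ := by
  have h2 := hq.two_le
  have hNp : normExp q ℓ ≠ 0 := by have := succ_le_normExp h2 hℓ; omega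
  have key := Finset.card_fiber_eq_of_card_le (s := Finset.univ.filter fun b : F => b ≠ 0)
    (t := Finset.univ.filter fun c : F => c ^ (q - 1) = 1)
    (f := fun b => b ^ normExp q ℓ) (k := normExp q ℓ) (b := q - 1) ?_
    (fun c _ => card_filter_pow_eq_le hNp c _) (card_filter_pow_eq_le (by omega) 1 _) ?_ c ?_
  · refine Eq.trans ?_ key
    rw [Finset.filter_filter]
    refine congrArg Finset.card (Finset.ext fun b => ?_)
    simp only [Finset.mem_filter, Finset.mem_univ, true_and]
    refine ⟨fun h => ⟨?_, h⟩, fun h => h.2⟩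
    rintro rfl
    exact hc0 (by rw [← h, zero_pow hNp])
  · intro b hb
    have hb : b ≠ 0 := by simpa using hb
    simp only [Finset.mem_filter, Finset.mem_univ, true_and]
    rw [← pow_mul, normExp_mul, ← hF, FiniteField.pow_card_sub_one_eq_one b hb]
  · rw [Finset.filter_ne', Finset.card_erase_of_mem (Finset.mem_univ _), Finset.card_univ, hF,
      mul_comm, normExp_mul]
  · simp only [Finset.mem_filter, Finset.mem_univ, true_and]
    refine mul_right_cancel₀ hc0 ?_
    rw [← pow_succ, Nat.sub_add_cancel (by omega), hc, one_mul]

end FiniteField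

/-! ### Homomorphisms out of the coordinate ring and rational points -/

section Curve

variable {F : Type*} [Field F] {q ℓ : ℕ}

theorem tr_x : tr q ℓ (x F q ℓ) = y F q ℓ ^ normExp q ℓ := by
  have h : AdjoinRoot.mk (curvePoly F q ℓ) (curvePoly F q ℓ) = 0 := AdjoinRoot.mk_self
  conv at h => lhs; arg 2; rw [curvePoly]
  rw [map_sub, map_tr, AdjoinRoot.mk_X, AdjoinRoot.mk_C, map_pow, sub_eq_zero] at h
  exact h

/-- The homomorphism to `A` determined by an `A`-valued point of the curve. -/
noncomputable def liftHom {A : Type*} [CommRing A] [Algebra F A] (u v : A)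
    (h : tr q ℓ u = v ^ normExp q ℓ) : CoordRing F q ℓ →ₐ[F] A :=
  AdjoinRoot.liftAlgHom (curvePoly F q ℓ) (aeval v) u <| by
    have h2 := map_tr (q := q) (ℓ := ℓ) (eval₂RingHom (aeval (R := F) v : F[X] →+* A) u) X
    simp only [coe_eval₂RingHom, eval₂_X] at h2
    rw [curvePoly, eval₂_sub, eval₂_C]
    exact sub_eq_zero.2 (h2.trans (by simpa using h))

@[simp]
theorem liftHom_x {A : Type*} [CommRing A] [Algebra F A] (u v : A)
    (h : tr q ℓ u = v ^ normExp q ℓ) : liftHom (F := F) u v h (x F q ℓ) = u :=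
  AdjoinRoot.liftAlgHom_root _ _ _ _

@[simp]
theorem liftHom_y {A : Type*} [CommRing A] [Algebra F A] (u v : A)
    (h : tr q ℓ u = v ^ normExp q ℓ) : liftHom (F := F) u v h (y F q ℓ) = v :=
  (AdjoinRoot.liftAlgHom_of _ _ _ _ _).trans (aeval_X v)

theorem coordRing_algHom_ext {A : Type*} [CommRing A] [Algebra F A] {φ ψ : CoordRing F q ℓ →ₐ[F] A}
    (hx : φ (x F q ℓ) = ψ (x F q ℓ)) (hy : φ (y F q ℓ) = ψ (y F q ℓ)) : φ = ψ := by
  have key : (φ : CoordRing F q ℓ →+* A) = ψ := by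
    refine AdjoinRoot.ringHom_ext (Polynomial.ringHom_ext (fun a => ?_) hy) hx
    have h : ((AdjoinRoot.of (curvePoly F q ℓ)) (C a)) = algebraMap F (CoordRing F q ℓ) a := rfl
    simp [h]
  exact AlgHom.ext fun f => congrArg (fun χ : CoordRing F q ℓ →+* A => χ f) key

theorem coordRing_algEquiv_ext {σ τ : CoordRing F q ℓ ≃ₐ[F] CoordRing F q ℓ}
    (hx : σ (x F q ℓ) = τ (x F q ℓ)) (hy : σ (y F q ℓ) = τ (y F q ℓ)) : σ = τ :=
  AlgEquiv.ext fun f => congrArg (fun χ : CoordRing F q ℓ →ₐ[F] CoordRing F q ℓ => χ f)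
    (coordRing_algHom_ext (φ := (σ : CoordRing F q ℓ →ₐ[F] CoordRing F q ℓ))
      (ψ := (τ : CoordRing F q ℓ →ₐ[F] CoordRing F q ℓ)) hx hy)

theorem point_tr (P : Point F q ℓ) : tr q ℓ (P (x F q ℓ)) = P (y F q ℓ) ^ normExp q ℓ := by
  have h := congrArg P (tr_x (F := F) (q := q) (ℓ := ℓ))
  rw [map_pow] at h
  exact (map_tr (P : CoordRing F q ℓ →+* F) _).symm.trans h

theorem move_apply_eq_iff {σ : CoordRing F q ℓ ≃ₐ[F] CoordRing F q ℓ} {P Q : Point F q ℓ} :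
    Q = move σ P ↔ Q (x F q ℓ) = P (σ⁻¹ (x F q ℓ)) ∧ Q (y F q ℓ) = P (σ⁻¹ (y F q ℓ)) :=
  ⟨fun h => by rw [h]; exact ⟨rfl, rfl⟩, fun h => point_ext h.1 h.2⟩

end Curve

/-! ### The automorphisms, the evaluation points and their orbits -/

section Automorphisms

variable {F : Type*} [Field F] {q ℓ : ℕ}

theorem ne_zero_of_pow_normExp_eq_one (hq : 2 ≤ q) (hℓ : 2 ≤ ℓ) {b : F}
    (hb : b ^ normExp q ℓ = 1) : b ≠ 0 := by
  rintro rfl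
  have := succ_le_normExp hq hℓ
  rw [zero_pow (by omega)] at hb
  exact zero_ne_one hb

/-- The origin lies on the curve. Nontriviality passes the characteristic of `F` to the coordinate
ring, where the trace polynomial is then additive. -/
theorem nontrivial_coordRing (hq : 2 ≤ q) (hℓ : 2 ≤ ℓ) : Nontrivial (CoordRing F q ℓ) := by
  have hN : normExp q ℓ ≠ 0 := by have := succ_le_normExp hq hℓ; omega
  exact (liftHom (F := F) (q := q) (ℓ := ℓ) (A := F) 0 0
    (by rw [tr_zero (by omega), zero_pow hN])).toRingHom.domain_nontrivial

theorem tr_add_of_algebra [Fintype F] {R : Type*} [CommRing R] [Nontrivial R] [Algebra F R]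
    (hq : IsPrimePow q) (hF : Fintype.card F = q ^ ℓ) (u v : R) :
    tr q ℓ (u + v) = tr q ℓ u + tr q ℓ v := by
  obtain ⟨p, k, hp, hc, hk⟩ := exists_charP hq hF
  have : Fact p.Prime := ⟨hp⟩
  have : CharP R p := charP_of_injective_algebraMap (algebraMap F R).injective p
  exact tr_add hk u v

theorem tr_neg_eq_zero [Fintype F] (hq : IsPrimePow q) (hF : Fintype.card F = q ^ ℓ) {a : F}
    (ha : tr q ℓ a = 0) : tr q ℓ (-a) = 0 := by
  have h := tr_add_of_algebra (F := F) hq hF a (-a)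
  rwa [add_neg_cancel, ha, zero_add, tr_zero hq.ne_zero, eq_comm] at h

/-- The endomorphism `x ↦ x + a`, `y ↦ b y` of the coordinate ring. -/
noncomputable def affineHom [Fintype F] (hq : IsPrimePow q) (hℓ : 2 ≤ ℓ)
    (hF : Fintype.card F = q ^ ℓ) (a b : F)
    (ha : tr q ℓ a = 0) (hb : b ^ normExp q ℓ = 1) : CoordRing F q ℓ →ₐ[F] CoordRing F q ℓ :=
  liftHom (x F q ℓ + algebraMap F _ a) (b • y F q ℓ) <| by
    have := nontrivial_coordRing (F := F) hq.two_le hℓ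
    rw [tr_add_of_algebra (F := F) hq hF, tr_x, ← map_tr, ha, map_zero, add_zero,
      _root_.smul_pow, hb,
      one_smul]

/-- The automorphism `x ↦ x + a`, `y ↦ b y` of the coordinate ring. -/
noncomputable def affineAut [Fintype F] (hq : IsPrimePow q) (hℓ : 2 ≤ ℓ)
    (hF : Fintype.card F = q ^ ℓ) (a b : F)
    (ha : tr q ℓ a = 0) (hb : b ^ normExp q ℓ = 1) : CoordRing F q ℓ ≃ₐ[F] CoordRing F q ℓ :=
  AlgEquiv.ofAlgHom (affineHom hq hℓ hF a b ha hb)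
    (affineHom hq hℓ hF (-a) b⁻¹ (tr_neg_eq_zero hq hF ha) (by rw [inv_pow, hb, inv_one]))
    (coordRing_algHom_ext (by simp [affineHom])
      (by simp [affineHom, ne_zero_of_pow_normExp_eq_one hq.two_le hℓ hb, smul_smul]))
    (coordRing_algHom_ext (by simp [affineHom])
      (by simp [affineHom, ne_zero_of_pow_normExp_eq_one hq.two_le hℓ hb, smul_smul]))

theorem affineAut_x [Fintype F] (hq : IsPrimePow q) (hℓ : 2 ≤ ℓ)
    (hF : Fintype.card F = q ^ ℓ) (a b : F)
    (ha : tr q ℓ a = 0) (hb : b ^ normExp q ℓ = 1) :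
    affineAut hq hℓ hF a b ha hb (x F q ℓ) = x F q ℓ + algebraMap F _ a := by
  simp [affineAut, affineHom]

theorem affineAut_y [Fintype F] (hq : IsPrimePow q) (hℓ : 2 ≤ ℓ)
    (hF : Fintype.card F = q ^ ℓ) (a b : F)
    (ha : tr q ℓ a = 0) (hb : b ^ normExp q ℓ = 1) :
    affineAut hq hℓ hF a b ha hb (y F q ℓ) = b • y F q ℓ := by
  simp [affineAut, affineHom]

/-- Automorphisms of this shape are closed under composition and inversion. -/
theorem exists_of_mem_sup [Fintype F] (hq : IsPrimePow q) (hℓ : 2 ≤ ℓ) (hF : Fintype.card F = q ^ ℓ)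
    {σ : CoordRing F q ℓ ≃ₐ[F] CoordRing F q ℓ}
    (hσ : σ ∈ translationGroup F q ℓ ⊔ scalingGroup F q ℓ) :
    ∃ a b : F, tr q ℓ a = 0 ∧ b ^ normExp q ℓ = 1 ∧
      σ (x F q ℓ) = x F q ℓ + algebraMap F _ a ∧ σ (y F q ℓ) = b • y F q ℓ := by
  have h0 : tr q ℓ (0 : F) = 0 := tr_zero hq.ne_zero
  rw [translationGroup, scalingGroup, ← Subgroup.closure_union] at hσ
  induction hσ using Subgroup.closure_induction with
  | mem σ h =>
    rcases h with ⟨a, ha, hx, hy⟩ | ⟨b, hb, hx, hy⟩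
    · exact ⟨a, 1, ha, one_pow _, hx, by rw [hy, one_smul]⟩
    · exact ⟨0, b, h0, hb, by rw [hx, map_zero, add_zero], hy⟩
  | one => exact ⟨0, 1, h0, one_pow _, by simp, by simp⟩
  | mul σ τ _ _ h1 h2 =>
    obtain ⟨a, b, ha, hb, hx, hy⟩ := h1
    obtain ⟨a', b', ha', hb', hx', hy'⟩ := h2
    refine ⟨a + a', b' * b, ?_, by rw [mul_pow, hb, hb', one_mul], ?_, ?_⟩
    · rw [tr_add_of_algebra (F := F) hq hF, ha, ha', add_zero]
    · rw [AlgEquiv.mul_apply, hx', map_add, hx, AlgEquiv.commutes, map_add, add_assoc]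
    · rw [AlgEquiv.mul_apply, hy', map_smul, hy, smul_smul]
  | inv σ _ h =>
    obtain ⟨a, b, ha, hb, hx, hy⟩ := h
    have hb0 := ne_zero_of_pow_normExp_eq_one hq.two_le hℓ hb
    have hinv : ∀ f, σ⁻¹ (σ f) = f := fun f => σ.symm_apply_apply f
    refine ⟨-a, b⁻¹, tr_neg_eq_zero hq hF ha, by rw [inv_pow, hb, inv_one], ?_, ?_⟩
    · have h := hinv (x F q ℓ)
      rw [hx, map_add, AlgEquiv.commutes] at h
      rw [map_neg, ← sub_eq_add_neg, eq_sub_iff_add_eq, h]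
    · have h := hinv (y F q ℓ)
      rw [hy, map_smul] at h
      rw [← h, smul_smul, inv_mul_cancel₀ hb0, one_smul, h]

theorem apply_y_of_mem_translationGroup {σ : CoordRing F q ℓ ≃ₐ[F] CoordRing F q ℓ}
    (hσ : σ ∈ translationGroup F q ℓ) : σ (y F q ℓ) = y F q ℓ := by
  induction hσ using Subgroup.closure_induction with
  | mem σ h => exact h.choose_spec.2.2
  | one => rfl
  | mul σ τ _ _ h1 h2 => rw [AlgEquiv.mul_apply, h2, h1]
  | inv σ _ h => exact σ.symm_apply_eq.2 h.symm

theorem apply_x_of_mem_scalingGroup {σ : CoordRing F q ℓ ≃ₐ[F] CoordRing F q ℓ}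
    (hσ : σ ∈ scalingGroup F q ℓ) : σ (x F q ℓ) = x F q ℓ := by
  induction hσ using Subgroup.closure_induction with
  | mem σ h => exact h.choose_spec.2.1
  | one => rfl
  | mul σ τ _ _ h1 h2 => rw [AlgEquiv.mul_apply, h2, h1]
  | inv σ _ h => exact σ.symm_apply_eq.2 h.symm

/-- If `y` vanishes at `P`, every scaling fixes `P`, and nontrivial ones exist since `N > 1`.
Otherwise `x + a = x` and `b * y = y` at `P` force `a = 0` and `b = 1`. -/
theorem mem_evalPoints_iff [Fintype F] (hq : IsPrimePow q) (hℓ : 2 ≤ ℓ)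
    (hF : Fintype.card F = q ^ ℓ)
    {P : Point F q ℓ} : P ∈ evalPoints F q ℓ ↔ P (y F q ℓ) ≠ 0 := by
  classical
  constructor
  · intro hP hy
    have h1 := card_filter_norm_eq hq hF hℓ (one_pow q) one_ne_zero
    have h2 : 1 < normExp q ℓ := by
      have := succ_le_normExp hq.two_le hℓ; have := hq.two_le; omega
    rw [← h1] at h2
    obtain ⟨b, hb, hb1⟩ := Finset.exists_mem_ne h2 1
    have hb : b ^ normExp q ℓ = 1 := by simpa using hb
    have h0 : tr q ℓ (0 : F) = 0 := tr_zero hq.ne_zero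
    have hx' := affineAut_x hq hℓ hF 0 b h0 hb
    have hy' := affineAut_y hq hℓ hF 0 b h0 hb
    set τ := affineAut hq hℓ hF 0 b h0 hb
    rw [map_zero, add_zero] at hx'
    have hτ : τ ∈ scalingGroup F q ℓ := Subgroup.subset_closure ⟨b, hb, hx', hy'⟩
    have hfix : P = move τ⁻¹ P := by
      rw [move_apply_eq_iff, inv_inv, hx', hy', map_smul, hy, smul_zero]
      exact ⟨rfl, rfl⟩
    have hτ1 := inv_eq_one.1 (hP τ⁻¹ (inv_mem (Subgroup.mem_sup_right hτ)) hfix.symm)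
    -- A point with `y = 1` shows that `b • y` and `y` differ as functions, so the scaling is not
    -- the identity.
    obtain ⟨a, ha⟩ : (Finset.univ.filter fun a : F => tr q ℓ a = 1).Nonempty := by
      rw [← Finset.card_pos, card_filter_tr_eq hq hF (by omega) (one_pow q)]
      exact Nat.pow_pos hq.pos
    let Q : Point F q ℓ := liftHom a 1 (by simpa using ha)
    have hQ := congrArg Q hy'
    rw [hτ1, AlgEquiv.one_apply, map_smul, liftHom_y, smul_eq_mul, mul_one] at hQ
    exact hb1 hQ.symm
  · intro hy σ hσ hP
    obtain ⟨a, b, -, -, hx', hy'⟩ := exists_of_mem_sup hq hℓ hF (inv_mem hσ)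
    obtain ⟨h1, h2⟩ := move_apply_eq_iff.1 hP.symm
    rw [hx', map_add, AlgHom.commutes] at h1
    rw [hy', map_smul, smul_eq_mul] at h2
    have ha : a = 0 := by simpa using h1
    have hb : b = 1 := mul_right_cancel₀ hy (by rw [← h2, one_mul])
    refine inv_eq_one.1 (coordRing_algEquiv_ext ?_ ?_)
    · rw [hx', ha, map_zero, add_zero]; rfl
    · rw [hy', hb, one_smul]; rfl

theorem puncturedOrbit_scalingGroup [Fintype F] (hq : IsPrimePow q) (hℓ : 2 ≤ ℓ)
    (hF : Fintype.card F = q ^ ℓ) (P : evalPoints F q ℓ) :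
    puncturedOrbit (scalingGroup F q ℓ) P =
      ({Q : evalPoints F q ℓ | (Q : Point F q ℓ) (x F q ℓ) = (P : Point F q ℓ) (x F q ℓ)} \ {P} :
        Set (evalPoints F q ℓ)) := by
  ext Q
  refine and_congr_left fun _ => ⟨?_, fun h => ?_⟩
  · rintro ⟨σ, hσ, h⟩
    have h := (move_apply_eq_iff.1 h).1
    rwa [apply_x_of_mem_scalingGroup (inv_mem hσ)] at h
  · have h : (Q : Point F q ℓ) (x F q ℓ) = (P : Point F q ℓ) (x F q ℓ) := h
    have hP := (mem_evalPoints_iff hq hℓ hF).1 P.2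
    have hb : ((Q : Point F q ℓ) (y F q ℓ) / (P : Point F q ℓ) (y F q ℓ)) ^ normExp q ℓ = 1 := by
      rw [div_pow, ← point_tr, ← point_tr, h, div_self]
      rw [point_tr]
      exact pow_ne_zero _ hP
    have h0 : tr q ℓ (0 : F) = 0 := tr_zero hq.ne_zero
    have hx' := affineAut_x hq hℓ hF 0 _ h0 hb
    have hy' := affineAut_y hq hℓ hF 0 _ h0 hb
    rw [map_zero, add_zero] at hx'
    -- The inverse appears because `move σ` evaluates at `σ⁻¹ f`.
    refine ⟨(affineAut hq hℓ hF 0 _ h0 hb)⁻¹,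
      inv_mem (Subgroup.subset_closure ⟨_, hb, hx', hy'⟩), ?_⟩
    rw [move_apply_eq_iff, inv_inv, hx', hy', map_smul, smul_eq_mul, div_mul_cancel₀ _ hP]
    exact ⟨h, rfl⟩

theorem puncturedOrbit_translationGroup [Fintype F] (hq : IsPrimePow q) (hℓ : 2 ≤ ℓ)
    (hF : Fintype.card F = q ^ ℓ) (P : evalPoints F q ℓ) :
    puncturedOrbit (translationGroup F q ℓ) P =
      ({Q : evalPoints F q ℓ | (Q : Point F q ℓ) (y F q ℓ) = (P : Point F q ℓ) (y F q ℓ)} \ {P} :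
        Set (evalPoints F q ℓ)) := by
  ext Q
  refine and_congr_left fun _ => ⟨?_, fun h => ?_⟩
  · rintro ⟨σ, hσ, h⟩
    have h := (move_apply_eq_iff.1 h).2
    rwa [apply_y_of_mem_translationGroup (inv_mem hσ)] at h
  · have h : (Q : Point F q ℓ) (y F q ℓ) = (P : Point F q ℓ) (y F q ℓ) := h
    have ha : tr q ℓ ((Q : Point F q ℓ) (x F q ℓ) - (P : Point F q ℓ) (x F q ℓ)) = 0 := by
      have h1 := tr_add_of_algebra (F := F) hq hF
        ((Q : Point F q ℓ) (x F q ℓ) - (P : Point F q ℓ) (x F q ℓ)) ((P : Point F q ℓ) (x F q ℓ))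
      rwa [sub_add_cancel, point_tr, point_tr, h, right_eq_add] at h1
    have hx' := affineAut_x hq hℓ hF _ 1 ha (one_pow _)
    have hy' := affineAut_y hq hℓ hF _ 1 ha (one_pow _)
    rw [one_smul] at hy'
    refine ⟨(affineAut hq hℓ hF _ 1 ha (one_pow _))⁻¹,
      inv_mem (Subgroup.subset_closure ⟨_, ha, hx', hy'⟩), ?_⟩
    rw [move_apply_eq_iff, inv_inv, hx', hy', map_add, AlgHom.commutes]
    exact ⟨by simp, h⟩

end Automorphisms

/-! ### Number of evaluation points and orbit sizes -/

section Counting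

variable {F : Type*} [Field F] [Fintype F] {q ℓ : ℕ}

/-- The evaluation point with coordinates `(u, v)`. -/
noncomputable def evalPoint (hq : IsPrimePow q) (hℓ : 2 ≤ ℓ) (hF : Fintype.card F = q ^ ℓ) {u v : F}
    (hv : v ≠ 0) (h : tr q ℓ u = v ^ normExp q ℓ) : evalPoints F q ℓ :=
  ⟨liftHom u v h, (mem_evalPoints_iff hq hℓ hF).2 (by rwa [liftHom_y])⟩

theorem evalPoint_x (hq : IsPrimePow q) (hℓ : 2 ≤ ℓ) (hF : Fintype.card F = q ^ ℓ) {u v : F}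
    (hv : v ≠ 0) (h : tr q ℓ u = v ^ normExp q ℓ) :
    (evalPoint hq hℓ hF hv h : Point F q ℓ) (x F q ℓ) = u :=
  liftHom_x u v h

theorem evalPoint_y (hq : IsPrimePow q) (hℓ : 2 ≤ ℓ) (hF : Fintype.card F = q ^ ℓ) {u v : F}
    (hv : v ≠ 0) (h : tr q ℓ u = v ^ normExp q ℓ) :
    (evalPoint hq hℓ hF hv h : Point F q ℓ) (y F q ℓ) = v :=
  liftHom_y u v h

/-- The evaluation points in coordinates. -/
noncomputable def evalPointsEquiv (hq : IsPrimePow q) (hℓ : 2 ≤ ℓ) (hF : Fintype.card F = q ^ ℓ) :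
    evalPoints F q ℓ ≃ {p : F × F // p.2 ≠ 0 ∧ tr q ℓ p.1 = p.2 ^ normExp q ℓ} where
  toFun P := ⟨((P : Point F q ℓ) (x F q ℓ), (P : Point F q ℓ) (y F q ℓ)),
    (mem_evalPoints_iff hq hℓ hF).1 P.2, point_tr _⟩
  invFun p := evalPoint hq hℓ hF p.2.1 p.2.2
  left_inv _ := Subtype.ext (point_ext (evalPoint_x hq hℓ hF _ _) (evalPoint_y hq hℓ hF _ _))
  right_inv _ := Subtype.ext (Prod.ext (evalPoint_x hq hℓ hF _ _) (evalPoint_y hq hℓ hF _ _))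

theorem card_evalPoints [DecidableEq F] (hq : IsPrimePow q) (hℓ : 2 ≤ ℓ)
    (hF : Fintype.card F = q ^ ℓ) :
    Fintype.card (evalPoints F q ℓ) = q ^ (ℓ - 1) * (q ^ ℓ - 1) := by
  rw [Fintype.card_congr (evalPointsEquiv hq hℓ hF), Fintype.card_subtype,
    Finset.card_eq_sum_card_fiberwise (f := Prod.snd) (t := Finset.univ.filter fun b : F => b ≠ 0)
      (fun p hp => by simp_all)]
  have h : ∀ b ∈ Finset.univ.filter fun b : F => b ≠ 0, ((Finset.univ.filter fun p : F × F =>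
      p.2 ≠ 0 ∧ tr q ℓ p.1 = p.2 ^ normExp q ℓ).filter fun p => p.2 = b).card = q ^ (ℓ - 1) := by
    intro b hb
    rw [← card_filter_tr_eq hq hF (by omega) (norm_pow_self hq hF b)]
    refine Finset.card_bij (fun p _ => p.1) ?_ ?_ ?_
    · intro p hp
      simp only [Finset.mem_filter, Finset.mem_univ, true_and] at hp ⊢
      rw [hp.1.2, hp.2]
    · intro p hp p' hp' h
      simp only [Finset.mem_filter, Finset.mem_univ, true_and] at hp hp'
      exact Prod.ext h (hp.2.trans hp'.2.symm)
    · intro a ha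
      simp only [Finset.mem_filter, Finset.mem_univ, true_and] at ha hb
      exact ⟨(a, b), by simp [ha, hb], rfl⟩
  rw [Finset.sum_congr rfl h, Finset.sum_const, Finset.filter_ne',
    Finset.card_erase_of_mem (Finset.mem_univ _), Finset.card_univ, hF, smul_eq_mul, mul_comm]

theorem ncard_puncturedOrbit_scalingGroup [DecidableEq F] (hq : IsPrimePow q) (hℓ : 2 ≤ ℓ)
    (hF : Fintype.card F = q ^ ℓ) (P : evalPoints F q ℓ) :
    (puncturedOrbit (scalingGroup F q ℓ) P).ncard = normExp q ℓ - 1 := by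
  rw [puncturedOrbit_scalingGroup hq hℓ hF, Set.ncard_sdiff_singleton_of_mem (by simp)]
  have hP := (mem_evalPoints_iff hq hℓ hF).1 P.2
  have hN := succ_le_normExp hq.two_le hℓ
  have himg : (fun Q : evalPoints F q ℓ => (Q : Point F q ℓ) (y F q ℓ)) ''
      {Q : evalPoints F q ℓ | (Q : Point F q ℓ) (x F q ℓ) = (P : Point F q ℓ) (x F q ℓ)} =
      ((Finset.univ.filter fun b : F =>
        b ^ normExp q ℓ = (P : Point F q ℓ) (y F q ℓ) ^ normExp q ℓ : Finset F) : Set F) := by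
    ext b
    simp only [Set.mem_image, Set.mem_ofPred_eq, Finset.coe_filter, Finset.mem_univ, true_and]
    constructor
    · rintro ⟨Q, hQ, rfl⟩
      rw [← point_tr, hQ, point_tr]
    · intro hb
      have hb0 : b ≠ 0 := by
        rintro rfl
        rw [zero_pow (by omega)] at hb
        exact pow_ne_zero _ hP hb.symm
      exact ⟨evalPoint hq hℓ hF hb0 ((point_tr (P : Point F q ℓ)).trans hb.symm),
        evalPoint_x hq hℓ hF _ _, evalPoint_y hq hℓ hF _ _⟩
  rw [← Set.InjOn.ncard_image (f := fun Q : evalPoints F q ℓ => (Q : Point F q ℓ) (y F q ℓ))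
    fun Q hQ Q' hQ' h => Subtype.ext (point_ext (hQ.trans hQ'.symm) h), himg, Set.ncard_coe_finset,
    card_filter_norm_eq hq hF hℓ (norm_pow_self hq hF _) (pow_ne_zero _ hP)]

theorem ncard_puncturedOrbit_translationGroup [DecidableEq F] (hq : IsPrimePow q) (hℓ : 2 ≤ ℓ)
    (hF : Fintype.card F = q ^ ℓ) (P : evalPoints F q ℓ) :
    (puncturedOrbit (translationGroup F q ℓ) P).ncard = q ^ (ℓ - 1) - 1 := by
  rw [puncturedOrbit_translationGroup hq hℓ hF, Set.ncard_sdiff_singleton_of_mem (by simp)]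
  have hP := (mem_evalPoints_iff hq hℓ hF).1 P.2
  have himg : (fun Q : evalPoints F q ℓ => (Q : Point F q ℓ) (x F q ℓ)) ''
      {Q : evalPoints F q ℓ | (Q : Point F q ℓ) (y F q ℓ) = (P : Point F q ℓ) (y F q ℓ)} =
      ((Finset.univ.filter fun a : F =>
        tr q ℓ a = (P : Point F q ℓ) (y F q ℓ) ^ normExp q ℓ : Finset F) : Set F) := by
    ext a
    simp only [Set.mem_image, Set.mem_ofPred_eq, Finset.coe_filter, Finset.mem_univ, true_and]
    constructor
    · rintro ⟨Q, hQ, rfl⟩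
      rw [point_tr, hQ]
    · intro ha
      exact ⟨evalPoint hq hℓ hF hP ha, evalPoint_y hq hℓ hF _ _, evalPoint_x hq hℓ hF _ _⟩
  rw [← Set.InjOn.ncard_image (f := fun Q : evalPoints F q ℓ => (Q : Point F q ℓ) (x F q ℓ))
    fun Q hQ Q' hQ' h => Subtype.ext (point_ext h (hQ.trans hQ'.symm)), himg, Set.ncard_coe_finset,
    card_filter_tr_eq hq hF (by omega) (norm_pow_self hq hF _)]

end Counting

/-! ### Monomial basis and the space `V₁ ⊓ V₂` -/

section FunctionSpace

variable {F : Type*} [Field F] {q ℓ : ℕ}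

/-- The polynomial function on the curve defined by a polynomial in `F[x][y]` (outer variable `y`,
inner variable `x`). -/
noncomputable def polyFun : F[X][X] →+* CoordRing F q ℓ :=
  eval₂RingHom (aeval (R := F) (x F q ℓ) : F[X] →+* CoordRing F q ℓ) (y F q ℓ)

theorem point_polyFun (P : Point F q ℓ) (g : F[X][X]) :
    P (polyFun g) = g.evalEval (P (x F q ℓ)) (P (y F q ℓ)) := by
  have h : (P : CoordRing F q ℓ →+* F).comp polyFun =
      evalEvalRingHom (P (x F q ℓ)) (P (y F q ℓ)) := by
    refine ringHom_ext' (ringHom_ext' (RingHom.ext fun a => ?_) ?_) ?_ <;> simp [polyFun]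
  exact congrArg (fun φ : F[X][X] →+* F => φ g) h

theorem monic_curvePoly (hq : 2 ≤ q) (hℓ : 2 ≤ ℓ) :
    (curvePoly F q ℓ).Monic ∧ (curvePoly F q ℓ).natDegree = q ^ (ℓ - 1) :=
  monic_tr_X_sub_C hq (by omega) _

/-- The monomials `y ^ j * x ^ i`, `i < q ^ (ℓ - 1)`, as a basis of the coordinate ring. -/
noncomputable def monomialBasis (hq : 2 ≤ q) (hℓ : 2 ≤ ℓ) :
    Module.Basis (ℕ × Fin (curvePoly F q ℓ).natDegree) F (CoordRing F q ℓ) :=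
  -- The equation is monic in `x`, so the ring is free over the polynomials in `y` on the powers of
  -- `x`; these are combined with the powers of `y`.
  (Polynomial.basisMonomials F).smulTower (AdjoinRoot.powerBasis' (monic_curvePoly hq hℓ).1).basis

theorem monomialBasis_apply (hq : 2 ≤ q) (hℓ : 2 ≤ ℓ)
    (p : ℕ × Fin (curvePoly F q ℓ).natDegree) :
    monomialBasis hq hℓ p = y F q ℓ ^ p.1 * x F q ℓ ^ (p.2 : ℕ) := by
  have h : basisMonomials F p.1 = (X : F[X]) ^ p.1 := by
    simp [monomial_one_right_eq_X_pow]
  refine ((Module.Basis.smulTower_apply _ _ _).trans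
    (congrArg₂ (· • ·) h (PowerBasis.basis_eq_pow _ _))).trans ?_
  refine (Algebra.smul_def _ _).trans (congrArg (· * _) ?_)
  exact map_pow (AdjoinRoot.of (curvePoly F q ℓ)) X p.1

theorem V₁_eq_span (hq : 2 ≤ q) (hℓ : 2 ≤ ℓ) (t₁ : ℕ) :
    V₁ F q ℓ t₁ = Submodule.span F (monomialBasis hq hℓ ''
      {p | (p.2 : ℕ) ≤ q ^ (ℓ - 1) - 2 ∧ p.1 ≤ t₁}) := by
  rw [V₁]
  congr 1
  ext f
  constructor
  · rintro ⟨i, j, hi, hj, rfl⟩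
    have hd := (monic_curvePoly (F := F) hq hℓ).2
    have hpos : 0 < q ^ (ℓ - 1) := Nat.pow_pos (by omega)
    exact ⟨(j, ⟨i, by omega⟩), ⟨hi, hj⟩, monomialBasis_apply hq hℓ _⟩
  · rintro ⟨p, ⟨hi, hj⟩, rfl⟩
    exact ⟨p.2, p.1, hi, hj, monomialBasis_apply hq hℓ p⟩

/-- The bound on `t₂` keeps all the monomials inside the basis; higher powers of `x` would have to
be reduced by the equation of the curve. -/
theorem V₂_eq_span (hq : 2 ≤ q) (hℓ : 2 ≤ ℓ) {t₂ : ℕ} (ht₂ : t₂ < q ^ (ℓ - 1)) :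
    V₂ F q ℓ t₂ = Submodule.span F (monomialBasis hq hℓ ''
      {p | p.1 ≤ normExp q ℓ - 2 ∧ (p.2 : ℕ) ≤ t₂}) := by
  rw [V₂]
  congr 1
  ext f
  constructor
  · rintro ⟨i, j, hi, hj, rfl⟩
    have hd := (monic_curvePoly (F := F) hq hℓ).2
    exact ⟨(i, ⟨j, by omega⟩), ⟨hi, hj⟩, (monomialBasis_apply hq hℓ _).trans (mul_comm _ _)⟩
  · rintro ⟨p, ⟨hi, hj⟩, rfl⟩
    exact ⟨p.1, p.2, hi, hj, (monomialBasis_apply hq hℓ p).trans (mul_comm _ _)⟩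

/-- Spans of two subsets of one basis meet in the span of their intersection. -/
theorem V₁_inf_V₂_eq_span (hq : 2 ≤ q) (hℓ : 2 ≤ ℓ) {t₁ t₂ m₁ m₂ : ℕ} (ht₂ : t₂ < q ^ (ℓ - 1))
    (hm₁ : m₁ = min t₁ (normExp q ℓ - 2)) (hm₂ : m₂ = min t₂ (q ^ (ℓ - 1) - 2)) :
    V₁ F q ℓ t₁ ⊓ V₂ F q ℓ t₂ = Submodule.span F (monomialBasis hq hℓ ''
      {p | p.1 ≤ m₁ ∧ (p.2 : ℕ) ≤ m₂}) := by
  ext f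
  rw [V₁_eq_span hq hℓ, V₂_eq_span hq hℓ ht₂, Submodule.mem_inf, Module.Basis.mem_span_image,
    Module.Basis.mem_span_image, Module.Basis.mem_span_image, ← Set.subset_inter_iff]
  refine iff_of_eq (congrArg _ (Set.ext fun p => ?_))
  simp only [Set.mem_inter_iff, Set.mem_ofPred_eq, hm₁, hm₂, le_min_iff]
  tauto

theorem finrank_V₁_inf_V₂ (hq : 2 ≤ q) (hℓ : 2 ≤ ℓ) {t₁ t₂ m₁ m₂ : ℕ} (ht₂ : t₂ < q ^ (ℓ - 1))
    (hm₁ : m₁ = min t₁ (normExp q ℓ - 2)) (hm₂ : m₂ = min t₂ (q ^ (ℓ - 1) - 2)) :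
    Module.finrank F (V₁ F q ℓ t₁ ⊓ V₂ F q ℓ t₂ : Submodule F (CoordRing F q ℓ)) =
      (m₁ + 1) * (m₂ + 1) := by
  classical
  have hd := (monic_curvePoly (F := F) hq hℓ).2
  rw [V₁_inf_V₂_eq_span hq hℓ ht₂ hm₁ hm₂]
  let φ : Fin (m₁ + 1) × Fin (m₂ + 1) → ℕ × Fin (curvePoly F q ℓ).natDegree :=
    fun p => (p.1, ⟨p.2, by omega⟩)
  have hφ : Function.Injective φ := fun p p' h => by
    simp only [φ, Prod.mk.injEq, Fin.mk.injEq] at h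
    exact Prod.ext (Fin.ext h.1) (Fin.ext h.2)
  have hrange : {p : ℕ × Fin (curvePoly F q ℓ).natDegree | p.1 ≤ m₁ ∧ (p.2 : ℕ) ≤ m₂} =
      Set.range φ := by
    ext p
    constructor
    · rintro ⟨h1, h2⟩
      exact ⟨(⟨p.1, by omega⟩, ⟨p.2, by omega⟩), rfl⟩
    · rintro ⟨p, rfl⟩
      exact ⟨Nat.lt_succ_iff.1 p.1.2, Nat.lt_succ_iff.1 p.2.2⟩
  rw [hrange, ← Set.range_comp,
    finrank_span_eq_card ((monomialBasis hq hℓ).linearIndependent.comp φ hφ)]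
  simp

theorem exists_polyFun_eq (hq : 2 ≤ q) (hℓ : 2 ≤ ℓ) {t₁ t₂ m₁ m₂ : ℕ} (ht₂ : t₂ < q ^ (ℓ - 1))
    (hm₁ : m₁ = min t₁ (normExp q ℓ - 2)) (hm₂ : m₂ = min t₂ (q ^ (ℓ - 1) - 2))
    {f : CoordRing F q ℓ} (hf : f ∈ V₁ F q ℓ t₁ ⊓ V₂ F q ℓ t₂) :
    ∃ g : F[X][X], g.natDegree ≤ m₁ ∧ (∀ j, (g.coeff j).natDegree ≤ m₂) ∧ polyFun g = f := by
  rw [V₁_inf_V₂_eq_span hq hℓ ht₂ hm₁ hm₂] at hf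
  induction hf using Submodule.span_induction with
  | mem f h =>
    obtain ⟨p, ⟨h1, h2⟩, rfl⟩ := h
    refine ⟨monomial p.1 (X ^ (p.2 : ℕ)), (natDegree_monomial_le _).trans h1, fun j => ?_, ?_⟩
    · rw [coeff_monomial]
      split_ifs
      · rwa [natDegree_X_pow]
      · simp
    · rw [monomialBasis_apply]
      simp [polyFun, mul_comm]
  | zero => exact ⟨0, by simp, by simp, map_zero _⟩
  | add f f' _ _ h h' =>
    obtain ⟨g, h1, h2, rfl⟩ := h
    obtain ⟨g', h1', h2', rfl⟩ := h'
    refine ⟨g + g', natDegree_add_le_of_degree_le h1 h1', fun j => ?_, map_add _ _ _⟩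
    rw [coeff_add]
    exact natDegree_add_le_of_degree_le (h2 j) (h2' j)
  | smul a f _ h =>
    obtain ⟨g, h1, h2, rfl⟩ := h
    refine ⟨C (C a) * g, (natDegree_C_mul_le _ _).trans h1, fun j => ?_, ?_⟩
    · rw [coeff_C_mul]
      exact (natDegree_C_mul_le _ _).trans (h2 j)
    · rw [map_mul, Algebra.smul_def]
      congr 1
      simp [polyFun]

end FunctionSpace

/-! ### Lower bound for the number of nonzero values -/

section Weight

variable {F : Type*} [Field F] [Fintype F] [DecidableEq F] {q ℓ : ℕ}

theorem le_card_filter_tr_ne_zero_and_eval_ne_zero (hq : 2 ≤ q) (hℓ : 2 ≤ ℓ)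
    (hF : Fintype.card F = q ^ ℓ) {p : F[X]} (hp : p ≠ 0) :
    q ^ ℓ - q ^ (ℓ - 1) - p.natDegree ≤
      (Finset.univ.filter fun u : F => tr q ℓ u ≠ 0 ∧ p.eval u ≠ 0).card := by
  have h1 := card_filter_tr_eq_le hq (by omega : 1 ≤ ℓ) (0 : F)
  have h2 : p.roots.toFinset.card ≤ p.natDegree :=
    (Multiset.toFinset_card_le _).trans (card_roots' _)
  have h3 : (Finset.univ : Finset F) ⊆
      (Finset.univ.filter fun u : F => tr q ℓ u ≠ 0 ∧ p.eval u ≠ 0) ∪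
        ((Finset.univ.filter fun u : F => tr q ℓ u = 0) ∪ p.roots.toFinset) := by
    intro u _
    by_cases ha : tr q ℓ u = 0 <;> by_cases hb : p.eval u = 0 <;> simp [ha, hb, hp]
  have h4 := (Finset.card_le_card h3).trans (Finset.card_union_le _ _)
  have h5 := Finset.card_union_le (Finset.univ.filter fun u : F => tr q ℓ u = 0) p.roots.toFinset
  rw [Finset.card_univ, hF] at h4
  omega

theorem le_card_filter_pow_eq_tr (hq : IsPrimePow q) (hℓ : 2 ≤ ℓ) (hF : Fintype.card F = q ^ ℓ)
    {u : F} (hu : tr q ℓ u ≠ 0) {p : F[X]} (hp : p ≠ 0) :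
    normExp q ℓ - p.natDegree ≤
      (Finset.univ.filter fun v : F => v ^ normExp q ℓ = tr q ℓ u ∧ p.eval v ≠ 0).card := by
  have h1 := card_filter_norm_eq hq hF hℓ (tr_pow hq hF u) hu
  have h2 : p.roots.toFinset.card ≤ p.natDegree :=
    (Multiset.toFinset_card_le _).trans (card_roots' _)
  have h3 : (Finset.univ.filter fun v : F => v ^ normExp q ℓ = tr q ℓ u) ⊆
      (Finset.univ.filter fun v : F => v ^ normExp q ℓ = tr q ℓ u ∧ p.eval v ≠ 0) ∪
        p.roots.toFinset := by
    intro v hv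
    have hv : v ^ normExp q ℓ = tr q ℓ u := by simpa using hv
    by_cases hb : p.eval v = 0 <;> simp [hv, hb, hp]
  have h4 := (Finset.card_le_card h3).trans (Finset.card_union_le _ _)
  omega

/-- A Schwartz-Zippel type bound for polynomials on the evaluation points. -/
theorem le_card_filter_evalEval_ne_zero (hq : IsPrimePow q) (hℓ : 2 ≤ ℓ)
    (hF : Fintype.card F = q ^ ℓ) {g : F[X][X]} (hg : g ≠ 0) {m₁ m₂ : ℕ} (h₁ : g.natDegree ≤ m₁)
    (h₂ : ∀ j, (g.coeff j).natDegree ≤ m₂) :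
    (q ^ ℓ - q ^ (ℓ - 1) - m₂) * (normExp q ℓ - m₁) ≤
      (Finset.univ.filter fun P : evalPoints F q ℓ =>
        g.evalEval ((P : Point F q ℓ) (x F q ℓ)) ((P : Point F q ℓ) (y F q ℓ)) ≠ 0).card := by
  have hN := succ_le_normExp hq.two_le hℓ
  -- Over each `u` in `U` lie `N` evaluation points, and `g` specialised at `x = u` is a nonzero
  -- polynomial in `y` of degree at most `m₁`.
  set U := Finset.univ.filter fun u : F => tr q ℓ u ≠ 0 ∧ g.leadingCoeff.eval u ≠ 0 with hU
  let W : Finset (F × F) := Finset.univ.filter fun p =>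
    p.1 ∈ U ∧ p.2 ^ normExp q ℓ = tr q ℓ p.1 ∧ g.evalEval p.1 p.2 ≠ 0
  have hUc : q ^ ℓ - q ^ (ℓ - 1) - m₂ ≤ U.card := by
    have h : q ^ ℓ - q ^ (ℓ - 1) - g.leadingCoeff.natDegree ≤ U.card :=
      le_card_filter_tr_ne_zero_and_eval_ne_zero hq.two_le hℓ hF (leadingCoeff_ne_zero.2 hg)
    have h' := h₂ g.natDegree
    rw [coeff_natDegree] at h'
    omega
  have hfib : ∀ u ∈ U, normExp q ℓ - m₁ ≤ (W.filter fun p => p.1 = u).card := by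
    intro u hu
    have hu' := hu
    simp only [hU, Finset.mem_filter, Finset.mem_univ, true_and] at hu'
    have hne : g.map (evalRingHom u) ≠ 0 := by
      intro h
      have := congrArg (fun p => p.coeff g.natDegree) h
      rw [coeff_map, coeff_natDegree, coeff_zero, coe_evalRingHom] at this
      exact hu'.2 this
    have h := le_card_filter_pow_eq_tr hq hℓ hF hu'.1 hne
    have hd : (g.map (evalRingHom u)).natDegree ≤ m₁ := natDegree_map_le.trans h₁
    refine (Nat.sub_le_sub_left hd _).trans (h.trans ?_)
    refine Finset.card_le_card_of_injOn (fun v => (u, v)) (fun v hv => ?_)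
      (fun v _ v' _ h => (Prod.ext_iff.1 h).2)
    simp only [Finset.coe_filter, Finset.mem_univ, true_and, Set.mem_ofPred_eq] at hv
    simp only [W, Finset.coe_filter, Finset.mem_filter, Finset.mem_univ, true_and,
      Set.mem_ofPred_eq, and_true]
    exact ⟨hu, hv.1, by rw [← map_evalRingHom_eval]; exact hv.2⟩
  have hWc : U.card * (normExp q ℓ - m₁) ≤ W.card := by
    rw [Finset.card_eq_sum_card_fiberwise (f := Prod.fst) (s := W) (t := U)
      (fun p hp => (Finset.mem_filter.1 hp).2.1), ← smul_eq_mul]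
    exact Finset.card_nsmul_le_sum _ _ _ hfib
  refine (Nat.mul_le_mul_right _ hUc).trans (hWc.trans ?_)
  refine Finset.card_le_card_of_surjOn
    (fun P => ((P : Point F q ℓ) (x F q ℓ), (P : Point F q ℓ) (y F q ℓ))) fun p hp => ?_
  simp only [W, hU, Finset.coe_filter, Finset.mem_filter, Finset.mem_univ, true_and,
    Set.mem_ofPred_eq] at hp
  obtain ⟨⟨h1, -⟩, h2, h3⟩ := hp
  have hp0 : p.2 ≠ 0 := by
    intro h
    rw [h, zero_pow (by omega)] at h2
    exact h1 h2.symm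
  refine ⟨evalPoint hq hℓ hF hp0 h2.symm, ?_, ?_⟩
  · simpa [evalPoint_x, evalPoint_y] using h3
  · simp [evalPoint_x, evalPoint_y]

theorem sub_le_mul_of_normExp (hq : 2 ≤ q) (hℓ : 2 ≤ ℓ) {M₁ M₂ m₁ m₂ : ℕ}
    (hM₁ : normExp q ℓ - 2 ≤ M₁) (hM₂ : q ^ (ℓ - 1) - 2 ≤ M₂) (hm₁ : m₁ ≤ normExp q ℓ - 2)
    (hm₂ : m₂ ≤ q ^ (ℓ - 1) - 2) :
    q ^ (ℓ - 1) * (q ^ ℓ - 1) - (M₁ * q + M₂ * (q ^ ℓ - 1)) ≤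
        (q ^ ℓ - q ^ (ℓ - 1) - m₂) * (normExp q ℓ - m₁) ∧
      0 < (q ^ ℓ - q ^ (ℓ - 1) - m₂) * (normExp q ℓ - m₁) := by
  have hN := succ_le_normExp hq hℓ
  have hNq := normExp_mul (q := q) (ℓ := ℓ)
  have hD2 : q ≤ q ^ (ℓ - 1) := Nat.le_self_pow (by omega) q
  have hDN : q ^ (ℓ - 1) + 1 ≤ normExp q ℓ := by
    obtain ⟨k, rfl⟩ := Nat.exists_eq_add_of_le' hℓ
    rw [normExp_eq_sum hq, Finset.sum_range_succ, Finset.sum_range_succ']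
    simp
  have hqD : q ^ ℓ = q * q ^ (ℓ - 1) := by rw [← pow_succ', Nat.sub_add_cancel (by omega)]
  rw [hqD] at hNq ⊢
  generalize q ^ (ℓ - 1) = D at *
  generalize normExp q ℓ = N at *
  have hqD2 : 2 * D ≤ q * D := Nat.mul_le_mul_right D hq
  -- The extreme case `m₁ = N - 2`, `m₂ = D - 2`, `M₁ = N - 2`, `M₂ = D - 2` suffices. Since `N * (q
  -- - 1) = q * D - 1`, it amounts to `0 ≤ q * D - 4 * D + 5 + N - 2 * q`.
  have hA : q * D - 2 * D + 2 ≤ q * D - D - m₂ := by omega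
  have hB : 2 ≤ N - m₁ := by omega
  have hmul := Nat.mul_le_mul hA hB
  refine ⟨le_trans ?_ hmul, lt_of_lt_of_le (by positivity) hmul⟩
  have h1 : (N - 2) * q + (D - 2) * (q * D - 1) ≤ M₁ * q + M₂ * (q * D - 1) :=
    add_le_add (Nat.mul_le_mul_right _ hM₁) (Nat.mul_le_mul_right _ hM₂)
  rw [Nat.sub_le_iff_le_add]
  refine le_trans ?_ (Nat.add_le_add_left h1 _)
  zify [(by omega : 2 ≤ N), (by omega : 2 ≤ D), (by omega : 1 ≤ q * D), hqD2]
  zify [(by omega : 1 ≤ q), (by omega : 1 ≤ q * D)] at hNq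
  -- For `q ≥ 3`, `N ≥ D + 1` bounds that quantity below by `(q - 3) * (D - 2)`. For `q = 2`, `N = 2
  -- * D - 1` and it is zero.
  rcases hq.lt_or_eq with h3 | h3
  · have hprod : (0 : ℤ) ≤ ((q : ℤ) - 3) * (D - 2) :=
      mul_nonneg (by omega) (by omega)
    zify at hDN
    nlinarith
  · subst h3
    push_cast at hNq ⊢
    nlinarith

end Weight

end NormTrace

/-! ### Recovering a column by interpolation -/

/-- The weights are values of the Lagrange basis polynomials and do not depend on `p`, so one linear
relation serves all rows of a generator matrix. -/
theorem Lagrange.exists_eval_eq_sum {F ι : Type*} [Field F] [DecidableEq ι] {s : Finset ι}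
    {v : ι → F} (hv : Set.InjOn v s) (u : F) :
    ∃ w : ι → F, ∀ p : F[X], p.degree < s.card → p.eval u = ∑ j ∈ s, w j * p.eval (v j) := by
  refine ⟨fun j => (Lagrange.basis s v j).eval u, fun p hp => ?_⟩
  conv_lhs => rw [Lagrange.eq_interpolate hv hp, Lagrange.interpolate_apply]
  simp [eval_finsetSum, mul_comm]

theorem IsGeneratorMatrix.mem {F ι : Type*} [Field F] {k : ℕ} {C : Submodule F (ι → F)}
    {G : Matrix (Fin k) ι F} (hG : IsGeneratorMatrix C G) (a : Fin k) : G a ∈ C := by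
  rw [← hG.span_eq]
  exact Submodule.subset_span ⟨a, rfl⟩

/-- If every codeword agrees on `R` and at `i` with the values of a polynomial of degree less than
`|R|`, then the column `i` of a generator matrix is spanned by the columns in `R`. -/
theorem IsGeneratorMatrix.col_mem_span {F ι : Type*} [Field F] [Finite ι] {k : ℕ}
    {C : Submodule F (ι → F)} {G : Matrix (Fin k) ι F} (hG : IsGeneratorMatrix C G) {R : Set ι}
    {v : ι → F} (hv : Set.InjOn v R) {i : ι}
    (h : ∀ c ∈ C, ∃ p : F[X], p.natDegree < R.ncard ∧ p.eval (v i) = c i ∧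
      ∀ j ∈ R, p.eval (v j) = c j) :
    G.col i ∈ Submodule.span F (G.col '' R) := by
  classical
  have hR := R.toFinite
  obtain ⟨w, hw⟩ := Lagrange.exists_eval_eq_sum (s := hR.toFinset) (v := v)
    (by simpa using hv) (v i)
  have hcol : G.col i = ∑ j ∈ hR.toFinset, w j • G.col j := by
    ext a
    obtain ⟨p, hp, hpi, hpj⟩ := h _ (hG.mem a)
    rw [Set.ncard_eq_toFinset_card R hR] at hp
    have h1 := hw p (degree_le_natDegree.trans_lt (by exact_mod_cast hp))
    rw [hpi] at h1
    rw [Finset.sum_apply]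
    refine Eq.trans h1 (Finset.sum_congr rfl fun j hj => ?_)
    rw [hpj j (hR.mem_toFinset.1 hj)]
    rfl
  rw [hcol]
  exact Submodule.sum_mem _ fun j hj => Submodule.smul_mem _ _
    (Submodule.subset_span ⟨j, hR.mem_toFinset.1 hj, rfl⟩)

/-! ### Parameters and repair sets of the code -/

namespace NormTrace

variable {F : Type*} [Field F] [Fintype F] [DecidableEq F] {q ℓ : ℕ}

theorem le_card_filter_apply_ne_zero (hq : IsPrimePow q) (hℓ : 2 ≤ ℓ)
    (hF : Fintype.card F = q ^ ℓ) {t₁ t₂ m₁ m₂ : ℕ} (ht₂ : t₂ < q ^ (ℓ - 1))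
    (hm₁ : m₁ = min t₁ (normExp q ℓ - 2)) (hm₂ : m₂ = min t₂ (q ^ (ℓ - 1) - 2))
    {f : CoordRing F q ℓ} (hf : f ∈ V₁ F q ℓ t₁ ⊓ V₂ F q ℓ t₂) (hf0 : f ≠ 0) :
    (q ^ ℓ - q ^ (ℓ - 1) - m₂) * (normExp q ℓ - m₁) ≤
      (Finset.univ.filter fun P : evalPoints F q ℓ => ev F q ℓ f P ≠ 0).card := by
  obtain ⟨g, h1, h2, rfl⟩ := exists_polyFun_eq hq.two_le hℓ ht₂ hm₁ hm₂ hf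
  have hg : g ≠ 0 := by
    rintro rfl
    exact hf0 (map_zero _)
  refine (le_card_filter_evalEval_ne_zero hq hℓ hF hg h1 h2).trans_eq ?_
  refine congrArg Finset.card (Finset.filter_congr fun P _ => ?_)
  rw [← point_polyFun]
  rfl

/-- The degrees `m₁ ≤ N - 2` and `m₂ ≤ D - 2` stay below the sizes `N - 1` and `D - 1` of the
punctured orbits. The orbits are disjoint because `x` and `y` together determine a point. -/
theorem areRepairSets_puncturedOrbit (hq : IsPrimePow q) (hℓ : 2 ≤ ℓ)
    (hF : Fintype.card F = q ^ ℓ) {t₁ t₂ m₁ m₂ k : ℕ} (ht₂ : t₂ < q ^ (ℓ - 1))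
    (hm₁ : m₁ = min t₁ (normExp q ℓ - 2)) (hm₂ : m₂ = min t₂ (q ^ (ℓ - 1) - 2))
    {G : Matrix (Fin k) (evalPoints F q ℓ) F} (hG : IsGeneratorMatrix (code F q ℓ t₁ t₂) G)
    (P : evalPoints F q ℓ) :
    AreRepairSets G P ![normExp q ℓ - 1, q ^ (ℓ - 1) - 1]
      ![puncturedOrbit (scalingGroup F q ℓ) P, puncturedOrbit (translationGroup F q ℓ) P] := by
  have hS := ncard_puncturedOrbit_scalingGroup hq hℓ hF P
  have hT := ncard_puncturedOrbit_translationGroup hq hℓ hF P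
  have hN := succ_le_normExp hq.two_le hℓ
  have hD : q ≤ q ^ (ℓ - 1) := Nat.le_self_pow (by omega) q
  have hq2 := hq.two_le
  have hdisj : Disjoint (puncturedOrbit (scalingGroup F q ℓ) P)
      (puncturedOrbit (translationGroup F q ℓ) P) := by
    rw [puncturedOrbit_scalingGroup hq hℓ hF, puncturedOrbit_translationGroup hq hℓ hF,
      Set.disjoint_left]
    rintro Q ⟨h1, h2⟩ ⟨h3, -⟩
    exact h2 (Subtype.ext (point_ext h1 h3))
  refine ⟨?_, ?_, ?_, ?_⟩
  · rw [Fin.forall_fin_two]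
    exact ⟨fun h => h.2 rfl, fun h => h.2 rfl⟩
  · intro j j' hj
    fin_cases j <;> fin_cases j'
    · exact absurd rfl hj
    · exact hdisj
    · exact hdisj.symm
    · exact absurd rfl hj
  · rw [Fin.forall_fin_two]
    exact ⟨hS, hT⟩
  · rw [Fin.forall_fin_two]
    constructor
    · change _ ∈ Submodule.span F (_ '' puncturedOrbit (scalingGroup F q ℓ) P)
      refine hG.col_mem_span (v := fun Q => (Q : Point F q ℓ) (y F q ℓ)) ?_ ?_
      · rw [puncturedOrbit_scalingGroup hq hℓ hF]
        exact fun Q hQ Q' hQ' h => Subtype.ext (point_ext (hQ.1.trans hQ'.1.symm) h)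
      · rintro _ ⟨f, hf, rfl⟩
        obtain ⟨g, h1, h2, rfl⟩ := exists_polyFun_eq hq.two_le hℓ ht₂ hm₁ hm₂ hf
        have hval : ∀ Q : evalPoints F q ℓ,
            (Q : Point F q ℓ) (x F q ℓ) = (P : Point F q ℓ) (x F q ℓ) →
            (g.map (evalRingHom ((P : Point F q ℓ) (x F q ℓ)))).eval
              ((Q : Point F q ℓ) (y F q ℓ)) = ev F q ℓ (polyFun g) Q := fun Q hQ => by
          rw [map_evalRingHom_eval, ← hQ, ← point_polyFun]
          rfl
        refine ⟨g.map (evalRingHom ((P : Point F q ℓ) (x F q ℓ))), ?_, hval P rfl, fun Q hQ => ?_⟩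
        · have hd := (natDegree_map_le (f := evalRingHom ((P : Point F q ℓ) (x F q ℓ)))).trans h1
          omega
        · rw [puncturedOrbit_scalingGroup hq hℓ hF] at hQ
          exact hval Q hQ.1
    · change _ ∈ Submodule.span F (_ '' puncturedOrbit (translationGroup F q ℓ) P)
      refine hG.col_mem_span (v := fun Q => (Q : Point F q ℓ) (x F q ℓ)) ?_ ?_
      · rw [puncturedOrbit_translationGroup hq hℓ hF]
        exact fun Q hQ Q' hQ' h => Subtype.ext (point_ext h (hQ.1.trans hQ'.1.symm))
      · rintro _ ⟨f, hf, rfl⟩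
        obtain ⟨g, h1, h2, rfl⟩ := exists_polyFun_eq hq.two_le hℓ ht₂ hm₁ hm₂ hf
        have hval : ∀ Q : evalPoints F q ℓ,
            (Q : Point F q ℓ) (y F q ℓ) = (P : Point F q ℓ) (y F q ℓ) →
            (g.eval (C ((P : Point F q ℓ) (y F q ℓ)))).eval
              ((Q : Point F q ℓ) (x F q ℓ)) = ev F q ℓ (polyFun g) Q := fun Q hQ => by
          rw [← hQ]
          exact (point_polyFun _ g).symm
        refine ⟨g.eval (C ((P : Point F q ℓ) (y F q ℓ))), ?_, hval P rfl, fun Q hQ => ?_⟩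
        · have hd : (g.eval (C ((P : Point F q ℓ) (y F q ℓ)))).natDegree ≤ m₂ := by
            rw [eval_eq_sum_range]
            refine natDegree_sum_le_of_forall_le _ _ fun j _ => ?_
            rw [← C_pow]
            exact (natDegree_mul_C_le _ _).trans (h2 j)
          omega
        · rw [puncturedOrbit_translationGroup hq hℓ hF] at hQ
          exact hval Q hQ.1

theorem isRecoverableCode_code (hq : IsPrimePow q) (hℓ : 2 ≤ ℓ)
    (hF : Fintype.card F = q ^ ℓ) {t₁ t₂ m₁ m₂ d : ℕ} (ht₂ : t₂ < q ^ (ℓ - 1))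
    (hm₁ : m₁ = min t₁ (normExp q ℓ - 2)) (hm₂ : m₂ = min t₂ (q ^ (ℓ - 1) - 2))
    (hd : d ≤ (q ^ ℓ - q ^ (ℓ - 1) - m₂) * (normExp q ℓ - m₁))
    (hpos : 0 < (q ^ ℓ - q ^ (ℓ - 1) - m₂) * (normExp q ℓ - m₁)) :
    IsRecoverableCode (code F q ℓ t₁ t₂) (q ^ (ℓ - 1) * (q ^ ℓ - 1)) ((m₁ + 1) * (m₂ + 1)) d
      ![normExp q ℓ - 1, q ^ (ℓ - 1) - 1] where
  length_eq := card_evalPoints hq hℓ hF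
  finrank_eq := by
    have hinj : Function.Injective ((ev F q ℓ).domRestrict (V₁ F q ℓ t₁ ⊓ V₂ F q ℓ t₂)) := by
      rw [injective_iff_map_eq_zero]
      rintro ⟨f, hf⟩ h
      by_contra hne
      have hf0 : f ≠ 0 := fun h => hne (Subtype.ext h)
      have hc := le_card_filter_apply_ne_zero hq hℓ hF ht₂ hm₁ hm₂ hf hf0
      have h : ev F q ℓ f = 0 := h
      simp only [h, Pi.zero_apply, ne_eq, not_true_eq_false, Finset.filter_false,
        Finset.card_empty] at hc
      omega
    rw [code, ← LinearMap.range_domRestrict, LinearMap.finrank_range_of_inj hinj,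
      finrank_V₁_inf_V₂ hq.two_le hℓ ht₂ hm₁ hm₂]
  le_dist := by
    rintro _ ⟨f, hf, rfl⟩ _ ⟨f', hf', rfl⟩ hne
    have hf0 : f - f' ≠ 0 := fun h => hne (by rw [sub_eq_zero.1 h])
    refine hd.trans ((le_card_filter_apply_ne_zero hq hℓ hF ht₂ hm₁ hm₂
      (Submodule.sub_mem _ hf hf') hf0).trans_eq ?_)
    refine congrArg Finset.card (Finset.filter_congr fun P _ => ?_)
    rw [map_sub, Pi.sub_apply, sub_ne_zero]
  locality _ hG P := ⟨_, areRepairSets_puncturedOrbit hq hℓ hF ht₂ hm₁ hm₂ hG P⟩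

/-- The designed distance bound forces `t₂ < q ^ (ℓ - 1)`. -/
theorem lt_of_mul_add_mul_le (hq : 2 ≤ q) (hℓ : 2 ≤ ℓ) {M₁ M₂ : ℕ} (hM₁ : normExp q ℓ - 2 ≤ M₁)
    (h : M₁ * q + M₂ * (q ^ ℓ - 1) ≤ q ^ (ℓ - 1) * (q ^ ℓ - 1)) : M₂ < q ^ (ℓ - 1) := by
  have hN := succ_le_normExp hq hℓ
  by_contra! hle
  have h1 := Nat.mul_le_mul_right (q ^ ℓ - 1) hle
  -- Here `N ≥ 3`, so this summand is positive, which excludes even `M₂ = q ^ (ℓ - 1)`.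
  have h2 : 0 < M₁ * q := Nat.mul_pos (by omega) (by omega)
  omega

end NormTrace

theorem proposition4p6 (F : Type*) [Field F] [Fintype F] [DecidableEq F]
    (q ℓ : ℕ) (hq : IsPrimePow q) (hℓ : 2 ≤ ℓ) (hF : Fintype.card F = q ^ ℓ)
    (t₁ t₂ M₁ M₂ m₁ m₂ S : ℕ)
    (hM₁ : M₁ = max t₁ ((q ^ ℓ - 1) / (q - 1) - 2)) (hM₂ : M₂ = max t₂ (q ^ (ℓ - 1) - 2))
    (hm₁ : m₁ = min t₁ ((q ^ ℓ - 1) / (q - 1) - 2)) (hm₂ : m₂ = min t₂ (q ^ (ℓ - 1) - 2))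
    (hS : S = M₁ * q + M₂ * (q ^ ℓ - 1)) (hSn : S ≤ q ^ (ℓ - 1) * (q ^ ℓ - 1)) :
    IsRecoverableCode (NormTrace.code F q ℓ t₁ t₂)
        (q ^ (ℓ - 1) * (q ^ ℓ - 1)) ((m₁ + 1) * (m₂ + 1)) (q ^ (ℓ - 1) * (q ^ ℓ - 1) - S)
        ![(q ^ ℓ - 1) / (q - 1) - 1, q ^ (ℓ - 1) - 1] ∧
      ∀ G : Matrix (Fin ((m₁ + 1) * (m₂ + 1))) (NormTrace.evalPoints F q ℓ) F,
        IsGeneratorMatrix (NormTrace.code F q ℓ t₁ t₂) G →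
        ∀ P : NormTrace.evalPoints F q ℓ,
          AreRepairSets G P ![(q ^ ℓ - 1) / (q - 1) - 1, q ^ (ℓ - 1) - 1]
            ![NormTrace.puncturedOrbit (NormTrace.scalingGroup F q ℓ) P,
              NormTrace.puncturedOrbit (NormTrace.translationGroup F q ℓ) P] := by
  have hM₁' : NormTrace.normExp q ℓ - 2 ≤ M₁ := hM₁ ▸ le_max_right _ _
  have hM₂' : q ^ (ℓ - 1) - 2 ≤ M₂ := hM₂ ▸ le_max_right _ _
  subst hS
  have ht₂ : t₂ < q ^ (ℓ - 1) := lt_of_le_of_lt (hM₂ ▸ le_max_left _ _)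
    (NormTrace.lt_of_mul_add_mul_le hq.two_le hℓ hM₁' hSn)
  obtain ⟨hd, hpos⟩ := NormTrace.sub_le_mul_of_normExp hq.two_le hℓ hM₁' hM₂'
    (hm₁.le.trans (min_le_right _ _)) (hm₂.le.trans (min_le_right _ _))
  exact ⟨NormTrace.isRecoverableCode_code hq hℓ hF ht₂ hm₁ hm₂ hd hpos,
    fun _ hG P => NormTrace.areRepairSets_puncturedOrbit hq hℓ hF ht₂ hm₁ hm₂ hG P⟩
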